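/- A convex body in $\mathbb R^d$ is a compact convex set with non-empty interior; it is symmetric if there is a point $x_0\in\mathbb R^d$ such that $y\in\Omega$ implies $2x_0-y\in\Omega$. A set $\Lambda\subset\mathbb R^d$ is a spectrum of $\Omega$ if the exponentials $e^{2\pi i x\cdot\lambda}$, $\lambda\in\Lambda$, form an orthogonal basis of $L^2(\Omega)$, that is, they are pairwise orthogonal in $L^2(\Omega)$ and their linear span is dense there. **Theorem.** (1) Let $d\ge 2$ and let $\Omega\subset\mathbb R^d$ be a symmetric convex body whose boundary $\partial\Omega$ is smooth (a $C^\infty$ embedded hypersurface). Then $\Omega$ has no spectrum. (2) Let $\Omega\subset\mathbb R^2$ be a symmetric convex body whose boundary is piecewise smooth (a simple closed curve consisting of finitely many regular arcs that are $C^\infty$ up to their end points) and has at least one point of non-vanishing Gaussian curvature (a point near which $\partial\Omega$ is a smooth regular curve, and at which the curvature of this curve is not zero). Then $\Omega$ has no spectrum. -/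

import Mathlib

open Set MeasureTheory
open scoped ContDiff

noncomputable section

/-- A convex body in `ℝ^d`: a compact convex set with non-empty interior. -/
structure IsConvexBody {d : ℕ} (Ω : Set (EuclideanSpace ℝ (Fin d))) : Prop where
  convex : Convex ℝ Ω
  isCompact : IsCompact Ω
  interior_nonempty : (interior Ω).Nonempty

/-- `Ω` is symmetric with respect to some point `x₀`. -/
def IsSymmetricBody {d : ℕ} (Ω : Set (EuclideanSpace ℝ (Fin d))) : Prop :=
  ∃ x₀ : EuclideanSpace ℝ (Fin d), ∀ y ∈ Ω, (2 : ℝ) • x₀ - y ∈ Ω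

/-- The exponential `x ↦ e^{2π i x·l}`. -/
def expWave {d : ℕ} (l x : EuclideanSpace ℝ (Fin d)) : ℂ :=
  Complex.exp (2 * (Real.pi : ℂ) * Complex.I * ((inner ℝ x l : ℝ) : ℂ))

/-- `Λ` is a spectrum of `Ω`: the exponentials `e^{2π i x·l}`, `l ∈ Λ`, are an orthogonal basis of
the Hilbert space `L²(Ω)`, that is, they belong to `L²(Ω)`, are pairwise orthogonal there, and their
linear span is dense. (`e l` is the class of the exponential; it is unique.) -/
def IsSpectrum {d : ℕ} (Ω Λ : Set (EuclideanSpace ℝ (Fin d))) : Prop :=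
  ∃ e : Λ → Lp ℂ 2 (volume.restrict Ω),
    (∀ l : Λ, e l =ᵐ[volume.restrict Ω] expWave (l : EuclideanSpace ℝ (Fin d))) ∧
    Pairwise (fun l l' : Λ => inner ℂ (e l) (e l') = 0) ∧
    (Submodule.span ℂ (range e)).topologicalClosure = ⊤

/-- `S ⊆ ℝ^d` is a smooth (`C^∞`) embedded hypersurface: near each of its points it is the zero set
of a smooth function with non-vanishing differential at that point. -/
def IsSmoothHypersurface {d : ℕ} (S : Set (EuclideanSpace ℝ (Fin d))) : Prop :=
  ∀ p ∈ S, ∃ (U : Set (EuclideanSpace ℝ (Fin d))) (ρ : EuclideanSpace ℝ (Fin d) → ℝ),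
    IsOpen U ∧ p ∈ U ∧ ContDiffOn ℝ ∞ ρ U ∧ fderiv ℝ ρ p ≠ 0 ∧ S ∩ U = {x ∈ U | ρ x = 0}

/-- `S ⊆ ℝ²` is a piecewise smooth simple closed curve: it has a parametrization
`γ : [t 0, t n] → S`, closed and injective except for the common end point, which on each interval
`[t i, t (i+1)]` of a finite subdivision is `C^∞` up to the end points with non-zero (one-sided at
the end points) velocity. -/
def IsPiecewiseSmoothClosedCurve (S : Set (EuclideanSpace ℝ (Fin 2))) : Prop :=
  ∃ (n : ℕ) (t : Fin (n + 1) → ℝ) (γ : ℝ → EuclideanSpace ℝ (Fin 2)),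
    0 < n ∧ StrictMono t ∧
    γ (t 0) = γ (t (Fin.last n)) ∧
    InjOn γ (Ico (t 0) (t (Fin.last n))) ∧
    γ '' Icc (t 0) (t (Fin.last n)) = S ∧
    ∀ i : Fin n,
      ContDiffOn ℝ ∞ γ (Icc (t i.castSucc) (t i.succ)) ∧
      ∀ s ∈ Icc (t i.castSucc) (t i.succ), derivWithin γ (Icc (t i.castSucc) (t i.succ)) s ≠ 0

/-- The signed curvature `(x' y'' - y' x'') / (x'² + y'²)^{3/2}` of a regular plane curve
`γ = (x, y)`. -/
def planeCurvature (γ : ℝ → EuclideanSpace ℝ (Fin 2)) (s : ℝ) : ℝ :=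
  (deriv γ s 0 * iteratedDeriv 2 γ s 1 - deriv γ s 1 * iteratedDeriv 2 γ s 0) / ‖deriv γ s‖ ^ 3

/-- The set `S ⊆ ℝ²` is near `p` a smooth regular curve whose curvature at `p` is not zero. (For
curves in the plane, the Gaussian curvature is the curvature of the curve.) -/
def HasNonvanishingCurvatureAt (S : Set (EuclideanSpace ℝ (Fin 2)))
    (p : EuclideanSpace ℝ (Fin 2)) : Prop :=
  ∃ (U : Set (EuclideanSpace ℝ (Fin 2))) (a b s : ℝ) (γ : ℝ → EuclideanSpace ℝ (Fin 2)),
    IsOpen U ∧ p ∈ U ∧ s ∈ Ioo a b ∧ γ s = p ∧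
    InjOn γ (Ioo a b) ∧ γ '' Ioo a b = S ∩ U ∧
    ContDiffOn ℝ ∞ γ (Ioo a b) ∧ (∀ r ∈ Ioo a b, deriv γ r ≠ 0) ∧
    planeCurvature γ s ≠ 0

end

open Filter Topology

/-! Suppose `Ω` has a spectrum. Parseval for the indicators of two balls `B(a, η)`, `B(b, η)` inside
`Ω` shows that the almost periodic function `F`, whose coefficients are the squared moduli of the
ball's Fourier coefficients, vanishes at `b - a` once the balls are disjoint. Since `F` is a series
in orthogonal exponentials, the integral of `‖F‖ ^ 2` over a translate of `Ω` is a positive constant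
(`exists_measure_of_orthogonal_expWave`).

Centre `Ω` at `0` and translate it by `(1 + s) • P k`, with `P k` on the boundary and `s > 0` small.
If no hyperplane supports `Ω` at both `P k` and `P l`, a point `z` common to two such translates has
`z / 2` well inside `Ω`, so by symmetry it is a difference of centres and `F z = 0`. The translates
are then disjoint for the measure, have equal mass and stay in a bounded region of finite mass, so
there cannot be infinitely many (`not_exists_measure_of_noCommonSupport`). Smoothness or a point of
non-zero curvature supplies infinitely many such `P k`. -/

/-! ### Orthogonal expansions in a Hilbert space -/

theorem hasSum_inner_mul_inner_of_orthogonal {ι H : Type*} [NormedAddCommGroup H]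
    [InnerProductSpace ℂ H] [CompleteSpace H] {e : ι → H} {V : ℝ} (hV : 0 < V)
    (hn : ∀ i, ‖e i‖ ^ 2 = V) (ho : Pairwise fun i j => inner ℂ (e i) (e j) = 0)
    (hd : (Submodule.span ℂ (range e)).topologicalClosure = ⊤) (x y : H) :
    HasSum (fun i => inner ℂ x (e i) * inner ℂ (e i) y) (V * inner ℂ x y) := by
  set r : ℂ := (((√V)⁻¹ : ℝ) : ℂ) with hr
  have hr0 : r ≠ 0 := by
    rw [hr]; exact_mod_cast inv_ne_zero (Real.sqrt_ne_zero'.2 hV)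
  have hV0 : (V : ℂ) ≠ 0 := by exact_mod_cast hV.ne'
  have hrr : r * r = (V : ℂ)⁻¹ := by
    rw [hr, ← Complex.ofReal_mul, ← mul_inv, Real.mul_self_sqrt hV.le, Complex.ofReal_inv]
  have hon : Orthonormal ℂ (fun i => r • e i) := by
    refine ⟨fun i => ?_, fun i j hij => ?_⟩
    · have h1 : ‖e i‖ = √V := by rw [← hn i, Real.sqrt_sq (norm_nonneg _)]
      rw [norm_smul, hr, Complex.norm_real, h1, norm_inv, Real.norm_of_nonneg (Real.sqrt_nonneg _)]
      exact inv_mul_cancel₀ (Real.sqrt_ne_zero'.2 hV)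
    · simp [inner_smul_left, inner_smul_right, ho hij]
  have hspan : Submodule.span ℂ (range fun i => r • e i) = Submodule.span ℂ (range e) := by
    apply le_antisymm
    · rw [Submodule.span_le]
      rintro _ ⟨i, rfl⟩
      exact Submodule.smul_mem _ _ (Submodule.subset_span ⟨i, rfl⟩)
    · rw [Submodule.span_le]
      rintro _ ⟨i, rfl⟩
      have : e i = r⁻¹ • (r • e i) := by rw [smul_smul, inv_mul_cancel₀ hr0, one_smul]
      rw [this]
      exact Submodule.smul_mem _ _ (Submodule.subset_span ⟨i, rfl⟩)
  let b := HilbertBasis.mk hon (by rw [hspan, hd])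
  have hb : ∀ i, b i = r • e i := fun i => by simp [b]
  have h := (b.hasSum_inner_mul_inner x y).mul_left (V : ℂ)
  refine h.congr_fun fun i => ?_
  rw [hb, inner_smul_left, inner_smul_right, hr, Complex.conj_ofReal, ← hr]
  calc _ = (V * (r * r)) * (inner ℂ x (e i) * inner ℂ (e i) y) := by
        rw [hrr, mul_inv_cancel₀ hV0, one_mul]
    _ = _ := by ring

/-- Pythagoras. Only the moduli of the coefficients enter, so changing their phases preserves the
norm. -/
theorem hasSum_norm_sq_of_orthogonal {ι H : Type*} [NormedAddCommGroup H]
    [InnerProductSpace ℂ H] {e : ι → H} {V : ℝ}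
    (hn : ∀ i, ‖e i‖ ^ 2 = V) (ho : Pairwise fun i j => inner ℂ (e i) (e j) = 0)
    {c : ι → ℂ} {h : H} (hc : HasSum (fun i => c i • e i) h) :
    HasSum (fun i => ‖c i‖ ^ 2 * V) (‖h‖ ^ 2) := by
  have h1 : ∀ i, inner ℂ (e i) h = c i * V := fun i => by
    have hs := hc.mapL (innerSL ℂ (e i))
    have hs' := hasSum_single (f := fun j => innerSL ℂ (e i) (c j • e j)) i (fun j hj => by
      simp [ho hj.symm])
    rw [innerSL_apply_apply] at hs
    rw [hs.unique hs', innerSL_apply_apply, inner_smul_right, inner_self_eq_norm_sq_to_K,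
      ← hn i]
    simp
  have hs := hc.mapL (innerSL ℂ h)
  rw [innerSL_apply_apply, inner_self_eq_norm_sq_to_K] at hs
  have key : ∀ i, innerSL ℂ h (c i • e i) = ((‖c i‖ ^ 2 * V : ℝ) : ℂ) := fun i => by
    rw [innerSL_apply_apply, inner_smul_right, ← inner_conj_symm, h1, map_mul,
      Complex.conj_ofReal, ← mul_assoc, Complex.mul_conj']
    push_cast; rfl
  simp only [key] at hs
  have h2 : ((‖h‖ : ℂ)) ^ 2 = ((‖h‖ ^ 2 : ℝ) : ℂ) := by push_cast; rfl
  rw [← Complex.hasSum_ofReal, ← h2]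
  exact hs

/-! ### The measure attached to a spectrum -/

section Waves

variable {d : ℕ}

theorem norm_expWave (l x : EuclideanSpace ℝ (Fin d)) : ‖expWave l x‖ = 1 := by
  have : expWave l x = Complex.exp ((2 * Real.pi * inner ℝ x l : ℝ) * Complex.I) := by
    unfold expWave; congr 1; push_cast; ring
  rw [this, Complex.norm_exp_ofReal_mul_I]

theorem expWave_add (l x y : EuclideanSpace ℝ (Fin d)) :
    expWave l (x + y) = expWave l x * expWave l y := by
  unfold expWave
  rw [← Complex.exp_add, inner_add_left]
  congr 1; push_cast; ring

theorem expWave_mul_conj (l x y : EuclideanSpace ℝ (Fin d)) :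
    expWave l x * starRingEnd ℂ (expWave l y) = expWave l (x - y) := by
  have h : expWave l x = expWave l (x - y) * expWave l y := by rw [← expWave_add, sub_add_cancel]
  rw [h, mul_assoc, Complex.mul_conj', norm_expWave]
  simp

theorem continuous_expWave (l : EuclideanSpace ℝ (Fin d)) : Continuous (expWave l) := by
  unfold expWave; fun_prop

/-- The exponential as a bounded continuous function. -/
noncomputable def boundedWave (l : EuclideanSpace ℝ (Fin d)) :
    BoundedContinuousFunction (EuclideanSpace ℝ (Fin d)) ℂ :=
  BoundedContinuousFunction.ofNormedAddCommGroup (expWave l) (continuous_expWave l) 1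
    fun x => (norm_expWave l x).le

theorem boundedWave_apply (l x : EuclideanSpace ℝ (Fin d)) : boundedWave l x = expWave l x := rfl

theorem norm_boundedWave_le (l : EuclideanSpace ℝ (Fin d)) : ‖boundedWave l‖ ≤ 1 :=
  BoundedContinuousFunction.norm_ofNormedAddCommGroup_le _ zero_le_one _

theorem setIntegral_ball_expWave (l a : EuclideanSpace ℝ (Fin d)) (η : ℝ) :
    ∫ y in Metric.ball a η, expWave l y =
      expWave l a * ∫ y in Metric.ball 0 η, expWave l y := by
  have h := (measurePreserving_add_left (volume : Measure (EuclideanSpace ℝ (Fin d)))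
    a).setIntegral_preimage_emb (measurableEmbedding_addLeft a) (expWave l) (Metric.ball a η)
  rw [← h, ← integral_const_mul]
  have hpre : (fun x => a + x) ⁻¹' Metric.ball a η = Metric.ball 0 η := by
    ext y; simp [Metric.mem_ball, dist_eq_norm]
  rw [hpre]
  simp only [expWave_add]

/-- A spectral set `Ω` admits a measure that charges all translates of `Ω` equally and vanishes on
the differences `b - a`, of norm at least `2 η`, of centres of balls of radius `η` contained in `Ω`.
Its density is the square of the sum of the exponentials weighted by the squared Fourier
coefficients of the indicator function of such a ball. -/
theorem exists_measure_of_orthogonal_expWave {Ω Λ : Set (EuclideanSpace ℝ (Fin d))}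
    (hΩ : IsCompact Ω) {μ : Measure (EuclideanSpace ℝ (Fin d))} (hμ : μ = volume.restrict Ω)
    {e : Λ → Lp ℂ 2 μ} (he : ∀ l : Λ, e l =ᵐ[μ] expWave (l : EuclideanSpace ℝ (Fin d)))
    (ho : Pairwise fun l l' : Λ => inner ℂ (e l) (e l') = 0)
    (hd : (Submodule.span ℂ (range e)).topologicalClosure = ⊤) {η : ℝ} (hη : 0 < η)
    {a₀ : EuclideanSpace ℝ (Fin d)} (ha₀ : Metric.ball a₀ η ⊆ Ω) :
    ∃ (ν : Measure (EuclideanSpace ℝ (Fin d))) (c : ENNReal), c ≠ 0 ∧ c ≠ ⊤ ∧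
      (∀ x, ν ((fun y => y - x) ⁻¹' Ω) = c) ∧
      ν {z | 2 * η ≤ ‖z‖ ∧ ∃ a, Metric.ball a η ⊆ Ω ∧ Metric.ball (a + z) η ⊆ Ω} = 0 := by
  have hΩm : MeasurableSet Ω := hΩ.measurableSet
  have hΩfin : volume Ω ≠ ⊤ := hΩ.measure_lt_top.ne
  have : IsFiniteMeasure μ := ⟨by rw [hμ, Measure.restrict_apply_univ]; exact hΩ.measure_lt_top⟩
  have hballpos : 0 < volume (Metric.ball a₀ η) := Metric.measure_ball_pos _ _ hη
  have hVpos : 0 < volume.real Ω :=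
    ENNReal.toReal_pos (hballpos.trans_le (measure_mono ha₀)).ne' hΩfin
  set V := volume.real Ω with hVdef
  let T := BoundedContinuousFunction.toLp (E := ℂ) 2 μ ℂ
  have heT : ∀ l : Λ, T (boundedWave l) = e l := fun l => by
    apply Lp.ext
    filter_upwards [BoundedContinuousFunction.coeFn_toLp 2 μ ℂ (boundedWave (l : _)), he l]
      with y h1 h2
    rw [h1, h2, boundedWave_apply]
  have hn : ∀ l, ‖e l‖ ^ 2 = V := fun l => by
    have h1 : (inner ℂ (e l) (e l) : ℂ) = (V : ℂ) := by
      rw [L2.inner_def]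
      have : ∀ᵐ y ∂μ, (inner ℂ (e l y) (e l y) : ℂ) = 1 := by
        filter_upwards [he l] with y hy
        rw [hy, inner_self_eq_norm_sq_to_K, norm_expWave]; simp
      rw [integral_congr_ae this]
      simp [hμ, hVdef]
    rw [inner_self_eq_norm_sq_to_K] at h1
    apply Complex.ofReal_injective
    rw [← h1]
    push_cast; rfl
  have hpars := hasSum_inner_mul_inner_of_orthogonal hVpos hn ho hd
  let G : Λ → ℂ := fun l => ∫ y in Metric.ball 0 η, expWave (l : EuclideanSpace ℝ (Fin d)) y
  let g : EuclideanSpace ℝ (Fin d) → Lp ℂ 2 μ := fun a =>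
    indicatorConstLp 2 (measurableSet_ball (x := a) (ε := η)) (measure_ne_top μ _) (1 : ℂ)
  have hg : ∀ a, Metric.ball a η ⊆ Ω → ∀ l : Λ,
      inner ℂ (g a) (e l) = expWave (l : EuclideanSpace ℝ (Fin d)) a * G l := fun a ha l => by
    rw [L2.inner_indicatorConstLp_one, ← setIntegral_ball_expWave]
    rw [integral_congr_ae (ae_restrict_of_ae (he l)), hμ,
      Measure.restrict_restrict measurableSet_ball, inter_eq_self_of_subset_left ha]
  let w : Λ → ℝ := fun l => ‖G l‖ ^ 2
  have hprod : ∀ a b, Metric.ball a η ⊆ Ω → Metric.ball b η ⊆ Ω →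
      HasSum (fun l : Λ => (w l : ℂ) * expWave (l : EuclideanSpace ℝ (Fin d)) (b - a))
        (V * μ.real (Metric.ball b η ∩ Metric.ball a η)) := fun a b ha hb => by
    have h1 := hpars (g b) (g a)
    have h2 : inner ℂ (g b) (g a) = ((μ.real (Metric.ball b η ∩ Metric.ball a η) : ℝ) : ℂ) := by
      rw [L2.inner_indicatorConstLp_indicatorConstLp]; simp
    rw [h2] at h1
    refine h1.congr_fun fun l => ?_
    rw [hg b hb, ← inner_conj_symm (e l), hg a ha, map_mul, ← expWave_mul_conj]
    simp only [w]
    push_cast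
    rw [← Complex.mul_conj']
    ring
  have hw0 : HasSum w (V * volume.real (Metric.ball a₀ η)) := by
    have h1 := hprod a₀ a₀ ha₀ ha₀
    rw [← Complex.hasSum_ofReal]
    convert h1 using 2 with l
    · simp [expWave]
    · rw [inter_self, hμ, measureReal_restrict_apply measurableSet_ball,
        inter_eq_self_of_subset_left ha₀]
      push_cast; rfl
  have hwpos : 0 < V * volume.real (Metric.ball a₀ η) :=
    mul_pos hVpos (ENNReal.toReal_pos hballpos.ne' measure_ball_lt_top.ne)
  -- A non-zero weight is what makes the common mass `c` positive.
  obtain ⟨l₀, hl₀⟩ : ∃ l, w l ≠ 0 := by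
    by_contra! hall
    have : w = fun _ => 0 := funext hall
    rw [this] at hw0
    exact hwpos.ne (hasSum_zero.unique hw0)
  have hsum : ∀ c : Λ → ℂ, (∀ l, ‖c l‖ = w l) →
      Summable fun l : Λ => c l • boundedWave (l : EuclideanSpace ℝ (Fin d)) := fun c hc => by
    refine Summable.of_norm_bounded hw0.summable fun l => ?_
    rw [norm_smul, hc]
    exact mul_le_of_le_one_right (sq_nonneg _) (norm_boundedWave_le _)
  let Φ : (Λ → ℂ) → BoundedContinuousFunction (EuclideanSpace ℝ (Fin d)) ℂ :=
    fun c => ∑' l : Λ, c l • boundedWave (l : EuclideanSpace ℝ (Fin d))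
  have hΦ : ∀ c : Λ → ℂ, (∀ l, ‖c l‖ = w l) → ∀ y,
      HasSum (fun l : Λ => c l * expWave (l : EuclideanSpace ℝ (Fin d)) y) (Φ c y) :=
    fun c hc y => (hsum c hc).hasSum.mapL (BoundedContinuousFunction.evalCLM ℂ y)
  have hTΦ : ∀ c : Λ → ℂ, (∀ l, ‖c l‖ = w l) →
      HasSum (fun l => w l ^ 2 * V) (‖T (Φ c)‖ ^ 2) := fun c hc => by
    have h1 := (hsum c hc).hasSum.mapL T
    simp only [map_smul, heT] at h1
    have h2 := hasSum_norm_sq_of_orthogonal hn ho h1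
    simpa only [hc] using h2
  have hwnn : ∀ l, 0 ≤ w l := fun l => sq_nonneg _
  let c₀ : Λ → ℂ := fun l => w l
  have hc₀ : ∀ l, ‖c₀ l‖ = w l := fun l => by
    simp only [c₀, Complex.norm_real, Real.norm_of_nonneg (hwnn l)]
  let F := Φ c₀
  have hTpos : 0 < ‖T F‖ ^ 2 := by
    have h1 := hTΦ c₀ hc₀
    have h2 : 0 < w l₀ ^ 2 * V := by positivity
    exact h2.trans_le (le_hasSum h1 l₀ fun j _ => by positivity)
  refine ⟨volume.withDensity fun y => ‖F y‖ₑ ^ 2, ENNReal.ofReal (‖T F‖ ^ 2),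
    by simpa only [ne_eq, ENNReal.ofReal_eq_zero, not_le] using hTpos, ENNReal.ofReal_ne_top,
    fun x => ?_, ?_⟩
  · have hmeas : Measurable fun y : EuclideanSpace ℝ (Fin d) => y - x := measurable_id.sub_const x
    rw [withDensity_apply _ (hmeas hΩm)]
    -- Translating `F` by `x` only multiplies its coefficients by phases.
    let cx : Λ → ℂ := fun l => w l * expWave (l : EuclideanSpace ℝ (Fin d)) x
    have hcx : ∀ l, ‖cx l‖ = w l := fun l => by
      simp only [cx, norm_mul, norm_expWave, mul_one]; exact hc₀ l
    have hFx : ∀ y, F y = Φ cx (y - x) := fun y => by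
      refine (hΦ c₀ hc₀ y).unique ?_
      refine (hΦ cx hcx (y - x)).congr_fun fun l => ?_
      simp only [cx, c₀]
      rw [mul_assoc, ← expWave_add, add_sub_cancel]
    simp only [hFx]
    have hFxm : Measurable fun y => ‖Φ cx y‖ₑ ^ 2 := by
      have := (Φ cx).continuous
      fun_prop
    rw [(measurePreserving_sub_right volume x).setLIntegral_comp_preimage hΩm hFxm]
    have hnorm : ‖T F‖ ^ 2 = ‖T (Φ cx)‖ ^ 2 := (hTΦ c₀ hc₀).unique (hTΦ cx hcx)
    rw [hnorm, ENNReal.ofReal_pow (norm_nonneg _), ofReal_norm, Lp.enorm_def,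
      eLpNorm_congr_ae (BoundedContinuousFunction.coeFn_toLp 2 μ ℂ (Φ cx)),
      eLpNorm_eq_lintegral_rpow_enorm_toReal two_ne_zero ENNReal.ofNat_ne_top]
    rw [← ENNReal.rpow_natCast, ← ENNReal.rpow_mul, hμ]
    simp
  · have hsub : {z | 2 * η ≤ ‖z‖ ∧ ∃ a, Metric.ball a η ⊆ Ω ∧ Metric.ball (a + z) η ⊆ Ω} ⊆
        F ⁻¹' {0} := by
      rintro z ⟨hz, a, ha, haz⟩
      have h1 := hprod a (a + z) ha haz
      have hdisj : Disjoint (Metric.ball (a + z) η) (Metric.ball a η) :=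
        Metric.ball_disjoint_ball (by simpa [two_mul] using hz)
      rw [hdisj.inter_eq, add_sub_cancel_left] at h1
      simpa using (hΦ c₀ hc₀ z).unique h1
    refine measure_mono_null hsub ?_
    have hm : MeasurableSet (F ⁻¹' {0}) := F.continuous.measurable (measurableSet_singleton _)
    rw [withDensity_apply _ hm, setLIntegral_congr_fun (g := fun _ => 0) hm (fun y hy => by
      rw [mem_preimage, mem_singleton_iff] at hy
      simp [hy])]
    simp

end Waves

/-! ### Packing translates of a symmetric convex body -/

section Geometry

variable {E : Type*} [NormedAddCommGroup E] [NormedSpace ℝ E]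

/-- No hyperplane supports `K` at both of the points `p` and `q`. -/
def NoCommonSupport (K : Set E) (p q : E) : Prop :=
  ∀ n : E →L[ℝ] ℝ, n ≠ 0 → (∀ x ∈ K, n x ≤ n p) → (∀ x ∈ K, n x ≤ n q) → False

/-- Otherwise a hyperplane supports `K` at the midpoint of `p, u`, which is also the midpoint of `q,
v`. A functional maximal at a midpoint is maximal at both ends, so it would support `K` at `p` and
at `q`. -/
theorem half_mem_interior_of_noCommonSupport {K : Set E} (hK : Convex ℝ K)
    (hint : (interior K).Nonempty) {p q u v : E} (hu : u ∈ K) (hv : v ∈ K)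
    (hpK : p ∈ K) (hqK : q ∈ K)
    (hpq : NoCommonSupport K p q) (h : p + u = q + v) :
    (2⁻¹ : ℝ) • (p + u) ∈ interior K := by
  by_contra hnot
  obtain ⟨n, hn⟩ := geometric_hahn_banach_open_point hK.interior isOpen_interior hnot
  have hle : ∀ x ∈ K, n x ≤ n ((2⁻¹ : ℝ) • (p + u)) := by
    have hclos : K ⊆ closure (interior K) := by
      rw [hK.closure_interior_eq_closure_of_nonempty_interior hint]; exact subset_closure
    intro x hx
    exact closure_minimal (t := {x | n x ≤ n ((2⁻¹ : ℝ) • (p + u))}) (fun y hy => (hn y hy).le)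
      (isClosed_le n.continuous continuous_const) (hclos hx)
  have hn0 : n ≠ 0 := by
    rintro rfl
    obtain ⟨y, hy⟩ := hint
    simpa using hn y hy
  have e1 : n ((2⁻¹ : ℝ) • (p + u)) = 2⁻¹ * (n p + n u) := by simp [mul_add]
  have e2 : n p + n u = n q + n v := by rw [← map_add, h, map_add]
  rw [e1] at hle
  have h1 := hle p hpK
  have h2 := hle u hu
  have h3 := hle q hqK
  have h4 := hle v hv
  refine hpq n hn0 (fun x hx => ?_) fun x hx => ?_
  · have := hle x hx; linarith
  · have := hle x hx; linarith

/-- Compactness: counterexamples with `s → 0` would accumulate at a configuration excluded by the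
case `s = 0`. -/
theorem eventually_disjoint_translates {K : Set E} (hK : Convex ℝ K)
    (hint : (interior K).Nonempty) (hcomp : IsCompact K) {p q : E} (hpK : p ∈ K) (hqK : q ∈ K)
    (hpq : NoCommonSupport K p q) :
    ∀ᶠ s : ℝ in 𝓝[>] 0, ∀ u ∈ K, ∀ v ∈ K, (1 + s) • p + u = (1 + s) • q + v →
      Metric.ball ((2⁻¹ : ℝ) • ((1 + s) • p + u)) s ⊆ K := by
  by_contra hev
  rw [not_eventually] at hev
  obtain ⟨s, hs0, hs⟩ := exists_seq_forall_of_frequently hev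
  push Not at hs
  choose u hu v hv huv hball using hs
  have hs0' : Tendsto s atTop (𝓝 0) := hs0.mono_right nhdsWithin_le_nhds
  obtain ⟨u₀, hu₀, φ, hφ, hlim⟩ := hcomp.tendsto_subseq hu
  have hsφ : Tendsto (s ∘ φ) atTop (𝓝 0) := hs0'.comp hφ.tendsto_atTop
  have h1 : ∀ r : E, Tendsto (fun k => (1 + s (φ k)) • r) atTop (𝓝 r) := fun r => by
    have : Tendsto (fun k => (1 + (s ∘ φ) k) • r) atTop (𝓝 ((1 + (0 : ℝ)) • r)) :=
      (tendsto_const_nhds.add hsφ).smul_const r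
    simpa using this
  have h2 : Tendsto (fun k => (1 + s (φ k)) • p + u (φ k)) atTop (𝓝 (p + u₀)) := (h1 p).add hlim
  have hv₀lim : Tendsto (fun k => v (φ k)) atTop (𝓝 (p + u₀ - q)) := by
    refine (h2.sub (h1 q)).congr fun k => ?_
    rw [huv (φ k)]; simp
  have hv₀ : p + u₀ - q ∈ K :=
    hcomp.isClosed.mem_of_tendsto hv₀lim (Eventually.of_forall fun k => hv (φ k))
  have hmem := half_mem_interior_of_noCommonSupport hK hint hu₀ hv₀ hpK hqK hpq
    (by abel)
  obtain ⟨r, hr, hrK⟩ := Metric.mem_nhds_iff.1 (mem_interior_iff_mem_nhds.1 hmem)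
  have h3 := h2.const_smul (2⁻¹ : ℝ)
  have h4 := (Metric.tendsto_nhds.1 h3 (r / 2) (by positivity)).and
    (hsφ.eventually (gt_mem_nhds (by positivity : 0 < r / 2)))
  obtain ⟨k, hk1, hk2⟩ := h4.exists
  refine hball (φ k) (Subset.trans ?_ hrK)
  apply Metric.ball_subset_ball'
  simp only [Function.comp] at hk2
  linarith

variable [MeasurableSpace E] [BorelSpace E] [ProperSpace E]

/-- Contradiction from equally charged translates, for a body with infinitely many boundary points
with pairwise disjoint normal cones. -/
theorem not_exists_measure_of_noCommonSupport {K : Set E} (hK : Convex ℝ K)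
    (hcomp : IsCompact K) (hsymm : ∀ x ∈ K, -x ∈ K) (h0 : (0 : E) ∈ interior K)
    (P : ℕ → E) (hP : ∀ k, P k ∈ frontier K)
    (hsep : Pairwise fun k l => NoCommonSupport K (P k) (P l)) :
    ¬ ∀ η > 0, Metric.ball 0 η ⊆ K → ∃ (ν : Measure E) (c : ENNReal), c ≠ 0 ∧ c ≠ ⊤ ∧
      (∀ x, ν ((fun y => y - x) ⁻¹' K) = c) ∧
      ν {z | 2 * η ≤ ‖z‖ ∧ ∃ a, Metric.ball a η ⊆ K ∧ Metric.ball (a + z) η ⊆ K} = 0 := by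
  intro hν
  have hPK : ∀ k, P k ∈ K := fun k => hcomp.isClosed.frontier_subset (hP k)
  have hPint : ∀ k, P k ∉ interior K := fun k => (hP k).2
  obtain ⟨r₀, hr₀, hr₀K⟩ := Metric.mem_nhds_iff.1 (mem_interior_iff_mem_nhds.1 h0)
  obtain ⟨R, hR⟩ := hcomp.isBounded.subset_closedBall (0 : E)
  have hRnorm : ∀ x ∈ K, ‖x‖ ≤ R := fun x hx => by simpa using hR hx
  -- As `s < 1`, every translate by `(1 + s) • P k` lies in the ball of radius `2 * R + R`. One
  -- translate more than the cover has members will be too many.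
  obtain ⟨t, -, ht⟩ := (isCompact_closedBall (0 : E) (3 * R)).elim_nhds_subcover
    (fun x => (fun y => y - x) ⁻¹' K) fun x _ => by
      refine (continuous_id.sub continuous_const).continuousAt ?_
      simpa using mem_interior_iff_mem_nhds.1 h0
  set M := Finset.range (t.card + 1)
  have hev : ∀ᶠ s : ℝ in 𝓝[>] 0, (∀ k ∈ M, ∀ l ∈ M, k ≠ l → ∀ u ∈ K, ∀ v ∈ K,
      (1 + s) • P k + u = (1 + s) • P l + v →
      Metric.ball ((2⁻¹ : ℝ) • ((1 + s) • P k + u)) s ⊆ K) ∧ 0 < s ∧ s < 1 := by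
    refine Eventually.and ?_ (Eventually.and self_mem_nhdsWithin
      (nhdsWithin_le_nhds (gt_mem_nhds one_pos)))
    rw [eventually_all_finset]
    intro k _
    rw [eventually_all_finset]
    intro l _
    by_cases hkl : k = l
    · exact Eventually.of_forall fun s h => (h hkl).elim
    · filter_upwards [eventually_disjoint_translates hK ⟨0, h0⟩ hcomp (hPK k) (hPK l) (hsep hkl)]
        with s hs _ using hs
  obtain ⟨s, hs, hs0, hs1⟩ := hev.exists
  let A : ℕ → Set E := fun k => (fun y => y - (1 + s) • P k) ⁻¹' K
  have hAcl : ∀ k, IsClosed (A k) := fun k =>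
    hcomp.isClosed.preimage (continuous_id.sub continuous_const)
  -- The factor `1 + s` pushes the translates off `0`; this later gives the bound `2 * η ≤ ‖z‖`.
  have hA0 : ∀ k, (0 : E) ∉ A k := fun k hk => by
    have h1 : (1 + s) • P k ∈ K := by simpa using hsymm _ hk
    have h2 := hK.combo_interior_self_mem_interior h0 h1 (a := s / (1 + s)) (b := (1 + s)⁻¹)
      (by positivity) (by positivity) (by field_simp; ring)
    rw [smul_zero, zero_add, smul_smul, inv_mul_cancel₀ (by positivity), one_smul] at h2
    exact hPint k h2
  have hnhds : (⋂ k ∈ M, (A k)ᶜ) ∈ 𝓝 (0 : E) :=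
    (biInter_finset_mem M).2 fun k _ => (hAcl k).isOpen_compl.mem_nhds (hA0 k)
  obtain ⟨δ, hδ, hδA⟩ := Metric.mem_nhds_iff.1 hnhds
  obtain ⟨η, hη, hηs, hηδ, hηr⟩ : ∃ η : ℝ, 0 < η ∧ η ≤ s ∧ 2 * η ≤ δ ∧ η ≤ r₀ :=
    ⟨min s (min (δ / 2) r₀), by positivity, min_le_left _ _, by
      have := (min_le_right s (min (δ / 2) r₀)).trans (min_le_left _ _)
      linarith, (min_le_right s (min (δ / 2) r₀)).trans (min_le_right _ _)⟩
  obtain ⟨ν, c, hc0, hctop, hνc, hνZ⟩ := hν η hη ((Metric.ball_subset_ball hηr).trans hr₀K)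
  have hdisj : (M : Set ℕ).Pairwise (Function.onFun (AEDisjoint ν) A) := by
    intro k hk l hl hkl
    refine measure_mono_null ?_ hνZ
    rintro z ⟨hzk, hzl⟩
    have hball := hs k hk l hl hkl _ hzk _ hzl (by simp only [add_sub_cancel])
    rw [add_sub_cancel] at hball
    have hball' := (Metric.ball_subset_ball hηs).trans hball
    -- The centres are `-z / 2` and `z / 2`; the ball about the first comes from the other by
    -- symmetry.
    refine ⟨?_, -((2⁻¹ : ℝ) • z), fun y hy => ?_, ?_⟩
    · by_contra! hlt
      have h1 := hδA (Metric.ball_subset_ball hηδ (mem_ball_zero_iff.2 hlt))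
      rw [mem_iInter₂] at h1
      exact h1 k hk hzk
    · rw [← neg_neg y]
      refine hsymm _ (hball' ?_)
      rw [Metric.mem_ball, dist_eq_norm] at hy ⊢
      rwa [← norm_neg, neg_sub, sub_neg_eq_add, add_comm, ← sub_neg_eq_add]
    · have : -((2⁻¹ : ℝ) • z) + z = (2⁻¹ : ℝ) • z := by module
      rwa [this]
  have hsub : (⋃ k ∈ M, A k) ⊆ ⋃ x ∈ t, (fun y => y - x) ⁻¹' K := by
    refine (iUnion₂_subset fun k _ z hz => ?_).trans ht
    rw [mem_closedBall_zero_iff]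
    have h1 := hRnorm _ hz
    have h2 := hRnorm _ (hPK k)
    have h3 : ‖(1 + s) • P k‖ ≤ 2 * R := by
      rw [norm_smul, Real.norm_of_nonneg (by positivity)]
      have := norm_nonneg (P k)
      nlinarith
    have h4 := norm_add_le (z - (1 + s) • P k) ((1 + s) • P k)
    rw [sub_add_cancel] at h4
    linarith
  have hle : ((t.card + 1 : ℕ) : ENNReal) * c ≤ (t.card : ENNReal) * c := by
    calc ((t.card + 1 : ℕ) : ENNReal) * c = ∑ k ∈ M, ν (A k) := by
          simp only [A, hνc, Finset.sum_const, M, Finset.card_range, nsmul_eq_mul]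
      _ = ν (⋃ k ∈ M, A k) :=
          (measure_biUnion_finset₀ hdisj fun k _ => (hAcl k).measurableSet.nullMeasurableSet).symm
      _ ≤ ν (⋃ x ∈ t, (fun y => y - x) ⁻¹' K) := measure_mono hsub
      _ ≤ ∑ x ∈ t, ν ((fun y => y - x) ⁻¹' K) := measure_biUnion_finset_le _ _
      _ = (t.card : ENNReal) * c := by simp only [hνc, Finset.sum_const, nsmul_eq_mul]
  have hle' := (ENNReal.mul_le_mul_iff_left hc0 hctop).1 hle
  have : t.card + 1 ≤ t.card := by exact_mod_cast hle'
  omega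

end Geometry

/-! ### Reduction to boundary points without common support -/

theorem not_isSpectrum_of_noCommonSupport {d : ℕ} {Ω : Set (EuclideanSpace ℝ (Fin d))}
    (hΩ : IsConvexBody Ω) (hsymm : IsSymmetricBody Ω) (P : ℕ → EuclideanSpace ℝ (Fin d))
    (hP : ∀ k, P k ∈ frontier Ω) (hsep : Pairwise fun k l => NoCommonSupport Ω (P k) (P l)) :
    ¬ ∃ Λ : Set (EuclideanSpace ℝ (Fin d)), IsSpectrum Ω Λ := by
  rintro ⟨Λ, e, he, ho, hd⟩
  obtain ⟨x₀, hx₀⟩ := hsymm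
  let T := Homeomorph.addRight x₀
  have hT : ∀ y, T y = y + x₀ := fun y => rfl
  set K := T ⁻¹' Ω with hK
  have hKc : Convex ℝ K := hΩ.convex.translate_preimage_left x₀
  have hKcomp : IsCompact K := T.isCompact_preimage.2 hΩ.isCompact
  have hKsymm : ∀ x ∈ K, -x ∈ K := fun x hx => by
    have := hx₀ _ hx
    rw [hK, mem_preimage, hT]
    rw [hT] at this
    convert this using 1
    module
  have hKint : (interior K).Nonempty := by
    rw [hK, ← T.preimage_interior]
    exact hΩ.interior_nonempty.preimage T.surjective
  have h0 : (0 : EuclideanSpace ℝ (Fin d)) ∈ interior K := by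
    obtain ⟨y, hy⟩ := hKint
    have := hKc.combo_interior_self_mem_interior hy (hKsymm y (interior_subset hy))
      (a := 1 / 2) (b := 1 / 2) (by norm_num) (by norm_num) (by norm_num)
    simpa using this
  have hball : ∀ a η, Metric.ball a η ⊆ K ↔ Metric.ball (a + x₀) η ⊆ Ω := fun a η => by
    have : Metric.ball a η = T ⁻¹' Metric.ball (a + x₀) η := by
      ext y; simp [hT]
    rw [this, hK, T.surjective.preimage_subset_preimage_iff]
  refine not_exists_measure_of_noCommonSupport hKc hKcomp hKsymm h0 (fun k => P k - x₀)
    (fun k => ?_) (fun k l hkl n hn hk hl => ?_) fun η hη hηK => ?_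
  · rw [hK, ← T.preimage_frontier, mem_preimage, hT, sub_add_cancel]
    exact hP k
  · have hmem : ∀ x ∈ Ω, x - x₀ ∈ K := fun x hx => by
      rw [hK, mem_preimage, hT, sub_add_cancel]; exact hx
    refine hsep hkl n hn (fun x hx => ?_) fun x hx => ?_
    · simpa using hk _ (hmem x hx)
    · simpa using hl _ (hmem x hx)
  · rw [hball] at hηK
    obtain ⟨ν, c, hc0, hctop, hν, hνZ⟩ :=
      exists_measure_of_orthogonal_expWave hΩ.isCompact rfl he ho hd hη hηK
    refine ⟨ν, c, hc0, hctop, fun x => ?_, measure_mono_null ?_ hνZ⟩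
    · rw [← hν (x - x₀), hK, ← preimage_comp]
      congr 2
      ext1 y
      simp only [Function.comp, hT]
      abel
    · rintro z ⟨hz, a, ha, haz⟩
      rw [hball] at ha haz
      exact ⟨hz, a + x₀, ha, by rwa [add_right_comm]⟩

/-! ### Smooth boundary -/

/-- Lagrange multipliers: a supporting functional is extremal at `p` on the level set of the
defining function, hence a multiple of its differential. -/
theorem exists_normal_of_isSmoothHypersurface {d : ℕ} {Ω : Set (EuclideanSpace ℝ (Fin d))}
    (hΩ : IsClosed Ω) (hs : IsSmoothHypersurface (frontier Ω)) {p : EuclideanSpace ℝ (Fin d)}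
    (hp : p ∈ frontier Ω) :
    ∃ f : EuclideanSpace ℝ (Fin d) →L[ℝ] ℝ, ∀ n : EuclideanSpace ℝ (Fin d) →L[ℝ] ℝ,
      (∀ x ∈ Ω, n x ≤ n p) → ∃ c : ℝ, n = c • f := by
  obtain ⟨U, ρ, hU, hpU, hρ, hρ', hUS⟩ := hs p hp
  have hstrict : HasStrictFDerivAt ρ (fderiv ℝ ρ p) p :=
    (hρ.contDiffAt (hU.mem_nhds hpU)).hasStrictFDerivAt (by simp)
  refine ⟨fderiv ℝ ρ p, fun n hn => ?_⟩
  have hρp : ρ p = 0 := by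
    have : p ∈ frontier Ω ∩ U := ⟨hp, hpU⟩
    rw [hUS] at this
    exact this.2
  have hext : IsLocalExtrOn n {x | ρ x = ρ p} p := by
    refine Or.inr ?_
    filter_upwards [self_mem_nhdsWithin, nhdsWithin_le_nhds (hU.mem_nhds hpU)] with x hx hxU
    have : x ∈ frontier Ω ∩ U := by
      rw [hUS]; exact ⟨hxU, hx.trans hρp⟩
    exact hn x (hΩ.frontier_subset this.1)
  obtain ⟨a, b, hab, h⟩ :=
    hext.exists_multipliers_of_hasStrictFDerivAt_1d hstrict n.hasStrictFDerivAt
  have hb : b ≠ 0 := by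
    rintro rfl
    rw [zero_smul, add_zero, smul_eq_zero] at h
    rcases h with rfl | h
    · exact hab rfl
    · exact hρ' h
  refine ⟨-(a / b), ?_⟩
  have h2 : b • n = -(a • fderiv ℝ ρ p) := by rw [eq_neg_iff_add_eq_zero, add_comm]; exact h
  rw [← inv_smul_smul₀ hb n, h2]
  module

theorem not_isSpectrum_of_isSmoothHypersurface {d : ℕ} {Ω : Set (EuclideanSpace ℝ (Fin d))}
    (hd : 2 ≤ d) (hΩ : IsConvexBody Ω) (hsymm : IsSymmetricBody Ω)
    (hs : IsSmoothHypersurface (frontier Ω)) :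
    ¬ ∃ Λ : Set (EuclideanSpace ℝ (Fin d)), IsSpectrum Ω Λ := by
  let i₀ : Fin d := ⟨0, by omega⟩
  let i₁ : Fin d := ⟨1, by omega⟩
  have hi : i₀ ≠ i₁ := by simp [i₀, i₁]
  -- Pairwise non-proportional functionals: a common support at two of their maximum points would be
  -- proportional to both.
  let N : ℕ → EuclideanSpace ℝ (Fin d) →L[ℝ] ℝ := fun k =>
    EuclideanSpace.proj i₀ + (k : ℝ) • EuclideanSpace.proj i₁
  have hN0 : ∀ k, N k (EuclideanSpace.single i₀ 1) = 1 := fun k => by simp [N, hi.symm]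
  have hN1 : ∀ k, N k (EuclideanSpace.single i₁ 1) = k := fun k => by simp [N, hi]
  have hmax : ∀ k, ∃ p ∈ Ω, ∀ x ∈ Ω, N k x ≤ N k p := fun k =>
    hΩ.isCompact.exists_isMaxOn (hΩ.interior_nonempty.mono interior_subset)
      (N k).continuous.continuousOn
  choose P hPΩ hPmax using hmax
  have hPf : ∀ k, P k ∈ frontier Ω := fun k => by
    refine ⟨subset_closure (hPΩ k), fun hint => ?_⟩
    have hloc : IsLocalMax (N k) (P k) := by
      filter_upwards [mem_interior_iff_mem_nhds.1 hint] with x hx using hPmax k x hx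
    have h0 := hloc.hasFDerivAt_eq_zero (N k).hasFDerivAt
    have h1 := hN0 k
    rw [h0] at h1
    simp at h1
  refine not_isSpectrum_of_noCommonSupport hΩ hsymm P hPf fun k l hkl n hn hk hl => hkl ?_
  have key : ∀ j, (∀ x ∈ Ω, n x ≤ n (P j)) → ∃ a : ℝ, N j = a • n := fun j hj => by
    obtain ⟨f, hf⟩ := exists_normal_of_isSmoothHypersurface hΩ.isCompact.isClosed hs (hPf j)
    obtain ⟨c, hc⟩ := hf n hj
    obtain ⟨c', hc'⟩ := hf (N j) (hPmax j)
    have hc0 : c ≠ 0 := by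
      rintro rfl
      exact hn (by rw [hc, zero_smul])
    exact ⟨c' / c, by rw [hc', hc, smul_smul, div_mul_cancel₀ _ hc0]⟩
  obtain ⟨a, ha⟩ := key k hk
  obtain ⟨b, hb⟩ := key l hl
  have a0 := hN0 k
  have a1 := hN1 k
  have b0 := hN0 l
  have b1 := hN1 l
  rw [ha, _root_.smul_apply, smul_eq_mul] at a0 a1
  rw [hb, _root_.smul_apply, smul_eq_mul] at b0 b1
  have hn0 : n (EuclideanSpace.single i₀ 1) ≠ 0 := right_ne_zero_of_mul (a0.trans_ne one_ne_zero)
  have hab : a = b := mul_right_cancel₀ hn0 (a0.trans b0.symm)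
  rw [hab, b1] at a1
  exact_mod_cast a1.symm

/-! ### A point of non-zero curvature -/

theorem functional_deriv_eq_zero {E : Type*} [NormedAddCommGroup E] [NormedSpace ℝ E]
    {K : Set E} {γ : ℝ → E} {r : ℝ} (hγ : DifferentiableAt ℝ γ r) (hK : ∀ᶠ t in 𝓝 r, γ t ∈ K)
    {n : E →L[ℝ] ℝ} (hn : ∀ x ∈ K, n x ≤ n (γ r)) : n (deriv γ r) = 0 := by
  have hloc : IsLocalMax (fun t => n (γ t)) r := by
    filter_upwards [hK] with t ht using hn _ ht
  exact hloc.hasDerivAt_eq_zero (n.hasFDerivAt.comp_hasDerivAt r hγ.hasDerivAt)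

/-- Near a point of non-zero curvature the slope of the tangent, measured in the frame of the
tangent at that point, takes infinitely many values. -/
theorem infinite_image_slope {γ : ℝ → EuclideanSpace ℝ (Fin 2)} {a b s : ℝ} (hs : s ∈ Ioo a b)
    (hγ : ContDiffOn ℝ ∞ γ (Ioo a b)) (hcurv : planeCurvature γ s ≠ 0) :
    ∃ v : EuclideanSpace ℝ (Fin 2), ((fun r => (v 0 * deriv γ r 1 - v 1 * deriv γ r 0) /
        (v 0 * deriv γ r 0 + v 1 * deriv γ r 1)) ''
      {r ∈ Ioo a b | v 0 * deriv γ r 0 + v 1 * deriv γ r 1 ≠ 0}).Infinite := by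
  set v := deriv γ s with hv
  refine ⟨v, ?_⟩
  set q : ℝ → ℝ := fun r => (v 0 * deriv γ r 1 - v 1 * deriv γ r 0) /
        (v 0 * deriv γ r 0 + v 1 * deriv γ r 1) with hq
  have hnum : v 0 * iteratedDeriv 2 γ s 1 - v 1 * iteratedDeriv 2 γ s 0 ≠ 0 := fun h0 =>
    hcurv (by rw [planeCurvature, ← hv, h0, zero_div])
  have hv0 : v 0 * v 0 + v 1 * v 1 ≠ 0 := fun h0 => hnum (by
    have h1 : v 0 = 0 := by nlinarith [mul_self_nonneg (v 0), mul_self_nonneg (v 1)]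
    have h2 : v 1 = 0 := by nlinarith [mul_self_nonneg (v 0), mul_self_nonneg (v 1)]
    rw [h1, h2]; ring)
  have hdγ : ContDiffOn ℝ ∞ (deriv γ) (Ioo a b) := hγ.deriv_of_isOpen isOpen_Ioo (by simp)
  have hd : HasDerivAt (deriv γ) (iteratedDeriv 2 γ s) s := by
    rw [iteratedDeriv_succ, iteratedDeriv_one]
    exact ((hdγ.contDiffAt (isOpen_Ioo.mem_nhds hs)).differentiableAt (by simp)).hasDerivAt
  have hd' : ∀ i, HasDerivAt (fun r => deriv γ r i) (iteratedDeriv 2 γ s i) s := fun i =>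
    ((EuclideanSpace.proj (𝕜 := ℝ) i).hasFDerivAt.comp_hasDerivAt s hd)
  have hqd := (((hd' 1).const_mul (v 0)).sub ((hd' 0).const_mul (v 1))).div
    (((hd' 0).const_mul (v 0)).add ((hd' 1).const_mul (v 1))) hv0
  -- At `s` the slope has non-zero derivative, a non-zero multiple of the curvature, so near `s` it
  -- avoids any finite set of values.
  have hne : ∀ c, ∀ᶠ r in 𝓝[≠] s, q r ≠ c := fun c => by
    refine hqd.eventually_ne ?_
    refine div_ne_zero ?_ (pow_ne_zero 2 hv0)
    have : v 0 * deriv γ s 1 - v 1 * deriv γ s 0 = 0 := by rw [← hv]; ring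
    simp only [Pi.add_apply, Pi.sub_apply]
    rw [this, zero_mul, sub_zero]
    exact mul_ne_zero hnum hv0
  intro hfin
  have h1 : ∀ᶠ r in 𝓝[≠] s, ∀ c ∈ q '' {r ∈ Ioo a b |
      v 0 * deriv γ r 0 + v 1 * deriv γ r 1 ≠ 0}, q r ≠ c :=
    (eventually_all_finite hfin).2 fun c _ => hne c
  have hcont : ContinuousAt (fun r => v 0 * deriv γ r 0 + v 1 * deriv γ r 1) s :=
    (((hd' 0).const_mul (v 0)).add ((hd' 1).const_mul (v 1))).continuousAt
  have h2 : ∀ᶠ r in 𝓝[≠] s, r ∈ Ioo a b ∧ v 0 * deriv γ r 0 + v 1 * deriv γ r 1 ≠ 0 :=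
    nhdsWithin_le_nhds ((isOpen_Ioo.eventually_mem hs).and (hcont.eventually_ne hv0))
  obtain ⟨r, hr1, hr2⟩ := (h1.and h2).exists
  exact hr1 _ ⟨r, hr2, rfl⟩ rfl

/-- A common supporting functional kills the tangents at both points, so in the plane these are
parallel and their slopes agree. Points with distinct slopes thus have no common support. -/
theorem not_isSpectrum_of_hasNonvanishingCurvatureAt {Ω : Set (EuclideanSpace ℝ (Fin 2))}
    (hΩ : IsConvexBody Ω) (hsymm : IsSymmetricBody Ω) {p : EuclideanSpace ℝ (Fin 2)}
    (hp : HasNonvanishingCurvatureAt (frontier Ω) p) :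
    ¬ ∃ Λ : Set (EuclideanSpace ℝ (Fin 2)), IsSpectrum Ω Λ := by
  obtain ⟨U, a, b, s, γ, -, -, hs, -, -, himg, hγ, -, hcurv⟩ := hp
  obtain ⟨v, hv⟩ := infinite_image_slope hs hγ hcurv
  have hfr : ∀ r ∈ Ioo a b, γ r ∈ frontier Ω := fun r hr =>
    (himg.subset (mem_image_of_mem γ hr)).1
  have hex : ∀ k : ℕ, ∃ r ∈ {r ∈ Ioo a b | v 0 * deriv γ r 0 + v 1 * deriv γ r 1 ≠ 0},
      (v 0 * deriv γ r 1 - v 1 * deriv γ r 0) / (v 0 * deriv γ r 0 + v 1 * deriv γ r 1) =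
        hv.natEmbedding _ k := fun k => (hv.natEmbedding _ k).2
  choose r hr hrq using hex
  refine not_isSpectrum_of_noCommonSupport hΩ hsymm (fun k => γ (r k)) (fun k => hfr _ (hr k).1)
    fun k l hkl n hn hk hl => hkl ?_
  have hperp : ∀ j, (∀ x ∈ Ω, n x ≤ n (γ (r j))) →
      n (EuclideanSpace.single 0 1) * deriv γ (r j) 0 +
        n (EuclideanSpace.single 1 1) * deriv γ (r j) 1 = 0 := fun j hj => by
    have hmem := isOpen_Ioo.mem_nhds (hr j).1
    have h1 := functional_deriv_eq_zero
      ((hγ.contDiffAt hmem).differentiableAt (by simp))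
      (by filter_upwards [hmem] with t ht using hΩ.isCompact.isClosed.frontier_subset (hfr t ht)) hj
    rw [← (EuclideanSpace.basisFun (Fin 2) ℝ).sum_repr (deriv γ (r j))] at h1
    simpa [Fin.sum_univ_two, mul_comm] using h1
  have hn01 : n (EuclideanSpace.single 0 1) ≠ 0 ∨ n (EuclideanSpace.single 1 1) ≠ 0 := by
    by_contra! h
    refine hn (ContinuousLinearMap.ext fun x => ?_)
    rw [← (EuclideanSpace.basisFun (Fin 2) ℝ).sum_repr x]
    simp [Fin.sum_univ_two, h.1, h.2]
  apply (hv.natEmbedding _).injective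
  apply Subtype.ext
  rw [← hrq k, ← hrq l, div_eq_div_iff (hr k).2 (hr l).2]
  have hk' := hperp k hk
  have hl' := hperp l hl
  set n0 := n (EuclideanSpace.single 0 1)
  set n1 := n (EuclideanSpace.single 1 1)
  set xk := deriv γ (r k) 0
  set yk := deriv γ (r k) 1
  set xl := deriv γ (r l) 0
  set yl := deriv γ (r l) 1
  have hdet : xk * yl - xl * yk = 0 := by
    rcases hn01 with h | h
    · apply mul_left_cancel₀ h
      linear_combination yl * hk' - yk * hl'
    · apply mul_left_cancel₀ h
      linear_combination xk * hl' - xl * hk'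
  -- In the frame of `v`, the cross-multiplied slopes differ by `-(v 0 ^ 2 + v 1 ^ 2)` times the
  -- determinant of the tangents.
  linear_combination (-(v 0) ^ 2 - (v 1) ^ 2) * hdet

theorem theorem0p1 :
    (∀ (d : ℕ) (Ω : Set (EuclideanSpace ℝ (Fin d))), 2 ≤ d →
      IsConvexBody Ω → IsSymmetricBody Ω →
      IsSmoothHypersurface (frontier Ω) →
      ¬ ∃ Λ : Set (EuclideanSpace ℝ (Fin d)), IsSpectrum Ω Λ) ∧
    (∀ Ω : Set (EuclideanSpace ℝ (Fin 2)),
      IsConvexBody Ω → IsSymmetricBody Ω →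
      IsPiecewiseSmoothClosedCurve (frontier Ω) →
      (∃ p ∈ frontier Ω, HasNonvanishingCurvatureAt (frontier Ω) p) →
      ¬ ∃ Λ : Set (EuclideanSpace ℝ (Fin 2)), IsSpectrum Ω Λ) :=
  ⟨fun _ _ hd hΩ hsymm hs => not_isSpectrum_of_isSmoothHypersurface hd hΩ hsymm hs,
    fun _ hΩ hsymm _ ⟨_, _, hp⟩ => not_isSpectrum_of_hasNonvanishingCurvatureAt hΩ hsymm hp⟩
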